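/- **Setting.** Let $\mathcal V,\mathcal W$ be symmetric monoidal categories, $F:\mathcal V\to\mathcal W$ a symmetric lax monoidal functor with comparison arrows $F_\varepsilon: I_{\mathcal W}\to FI_{\mathcal V}$ and $\tilde F_{A,B}:FA\otimes FB\to F(A\otimes B)$, and $(M,\mu,\eta,\nabla)$ a symmetric monoidal monad on $\mathcal W$. Let $\mathrm{Kl}_M$ be its Kleisli category, which has the objects of $\mathcal W$, arrows $X\to Y$ the arrows $X\to MY$ of $\mathcal W$, monoidal product $(f\otimes g);\nabla$ of arrows, and the coherence isomorphisms of $\mathcal W$ post-composed with $\eta$; let $L_M:\mathcal W\to\mathrm{Kl}_M$, $f\mapsto f;\eta$. Composition is written $;$ in diagrammatic order. Let $\mathcal U$ be a class of objects that contains $I_{\mathcal W}$ and is closed under $\otimes$, regarded as a full subcategory of $\mathrm{Kl}_M$, and assume that it is strict monoidal there: on objects of $\mathcal U$ the associators and unitors of $\mathrm{Kl}_M$ are identities. (This holds if $\mathcal U$ is a full strict monoidal subcategory of $\mathcal W$, or if $\mathrm{Kl}_M$ is strict.) Let $\mathcal C$ be a $\mathcal V$-category and $\mathcal C_0$ its underlying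 category, with $\mathcal C_0(X,Y)=\mathcal V(I_{\mathcal V},\mathcal C(X,Y))$, regarded as a 2-category with only identity 2-cells. Let $\mathcal U/(-):\mathrm{Kl}_M\to\mathbf{Cat}$ send $A$ to the comma category of arrows $U\to A$ with $U\in\mathcal U$, acting on arrows by post-composition; it is lax monoidal via $*\mapsto \mathrm{id}_I$ and $(f_1,f_2)\mapsto f_1\otimes f_2$. The 2-category $(\mathcal U/MF)_*\mathcal C$ is the change of base of $\mathcal C$ along $\mathcal V\xrightarrow{F}\mathcal W\xrightarrow{L_M}\mathrm{Kl}_M\xrightarrow{\mathcal U/(-)}\mathbf{Cat}$. Explicitly, its 0-cells are the objects of $\mathcal C$; its 1-cells $X\to Y$ are $\mathrm{Kl}_M$-arrows $f:U\to F\mathcal C(X,Y)$ with $U\in\mathcal U$ (the parameter space of $f$); its 2-cells from $f:U\to F\mathcal C(X,Y)$ to $g:V\to F\mathcal C(X,Y)$ are $\mathrm{Kl}_M$-arrows $\varphi:U\to V$ with $f=\varphi;g$. Vertical composition is that of $\mathrm{Kl}_M$; horizontal composition tensors the parameter spaces and post-composes with $L_M(\tilde F;F(\mathrm{comp}_{\mathcal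 C}))$. If $(\mathcal C,\boxtimes,J)$ is a monoidal $\mathcal V$-category, then $(\mathcal U/MF)_*\mathcal C$ carries the unit object $J$, the product $\boxtimes$ (that of $\mathcal C$ on 0-cells; on 1- and 2-cells it tensors the parameter spaces and post-composes with $L_M(\tilde F;F(\boxtimes_{\mathcal C}))$), the coherence 1-cells $F_\varepsilon;Fa;\eta$, $F_\varepsilon;Fl;\eta$, $F_\varepsilon;Fr;\eta$ with parameter space $I_{\mathcal W}$, where $a,l,r$ are the associators and unitors of $\mathcal C$, and the tensorators $(f_1\boxtimes f_2);(g_1\boxtimes g_2)\cong(f_1;g_1)\boxtimes(f_2;g_2)$, given by the middle-four symmetry of the parameter spaces. If $\mathcal C$ is symmetric with symmetry $s$, there are in addition the symmetry 1-cells $F_\varepsilon;Fs;\eta$ and the 2-cells $s;(f_2\boxtimes f_1)\cong(f_1\boxtimes f_2);s$, given by the symmetry of the parameter spaces. **Proposition 3.13.** There is a (strict) 2-functor $\iota:\mathcal C_0\to(\mathcal U/MF)_*\mathcal C$ that is the identity on objects and sends $f:I_{\mathcal V}\to\mathcal C(X,Y)$ to the 1-cell with parameter space $I_{\mathcal W}$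 $$ I_{\mathcal W}\xrightarrow{F_\varepsilon}FI_{\mathcal V}\xrightarrow{Ff}F\mathcal C(X,Y)\xrightarrow{\eta}MF\mathcal C(X,Y). $$ 1. If $\mathcal C$ is a monoidal $\mathcal V$-category, then $\iota$ strictly preserves the unit object, the monoidal product of 0- and 1-cells, the associators and the unitors, and the tensorators between 1-cells in the image of $\iota$ are identities. 2. If $\mathcal C$ is a symmetric monoidal $\mathcal V$-category, then $\iota$ also strictly preserves the symmetries, and the symmetry 2-cells $s;(f_2\boxtimes f_1)\cong(f_1\boxtimes f_2);s$ at 1-cells in the image of $\iota$ are identities. 3. Suppose that the functor $F_*^0:\mathcal C_0\to(F_*\mathcal C)_0$, $f\mapsto F_\varepsilon;Ff$, is faithful and that post-composition with $\eta$ is faithful, that is, $g\mapsto g;\eta_{F\mathcal C(X,Y)}$ is injective on $\mathcal W(I_{\mathcal W},F\mathcal C(X,Y))$ for all $X,Y$. Then $\iota$ is faithful: it is injective on the 1-cells $X\to Y$ of $\mathcal C_0$ for all $X,Y$. -/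

import Mathlib

set_option linter.unusedSectionVars false
open CategoryTheory MonoidalCategory Functor.LaxMonoidal

universe v u v₁ v₂ u₁ u₂ u₃

namespace ParamUncertainty

section KleisliMonoidal

variable {W : Type u} [Category.{v} W] (M : Monad W)

/-- The image `f ≫ η` of an arrow `f` of the base category in the Kleisli category. -/
def klMap {X Y : W} (f : X ⟶ Y) : Kleisli.mk M X ⟶ Kleisli.mk M Y :=
  Kleisli.Hom.mk (f ≫ M.η.app Y)

lemma klMap_id (X : W) : klMap M (𝟙 X) = 𝟙 (Kleisli.mk M X) :=
  (Kleisli.Adjunction.toKleisli M).map_id X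

lemma klMap_comp {X Y Z : W} (f : X ⟶ Y) (g : Y ⟶ Z) :
    klMap M (f ≫ g) = klMap M f ≫ klMap M g :=
  (Kleisli.Adjunction.toKleisli M).map_comp f g

lemma klMap_comp_of {X Y : W} {Z : Kleisli M} (f : X ⟶ Y) (k : Kleisli.mk M Y ⟶ Z) :
    (klMap M f ≫ k).of = f ≫ k.of := by
  have h := M.η.naturality_assoc k.of (M.μ.app Z.of)
  simp only [Functor.id_map] at h
  simp only [Kleisli.category_comp_of, klMap, Category.assoc]
  rw [← h, Monad.left_unit]
  exact congrArg (f ≫ ·) (Category.comp_id _)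

lemma comp_klMap_of {X : Kleisli M} {Y Z : W} (k : X ⟶ Kleisli.mk M Y) (f : Y ⟶ Z) :
    (k ≫ klMap M f).of = k.of ≫ M.map f := by
  simp only [Kleisli.category_comp_of, klMap, Functor.map_comp, Category.assoc]
  rw [Monad.right_unit]
  exact congrArg (k.of ≫ ·) (Category.comp_id _)

/-- The image of an isomorphism of the base category in the Kleisli category. -/
def klIso {X Y : W} (e : X ≅ Y) : Kleisli.mk M X ≅ Kleisli.mk M Y where
  hom := klMap M e.hom
  inv := klMap M e.inv
  hom_inv_id := by rw [← klMap_comp, e.hom_inv_id, klMap_id]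
  inv_hom_id := by rw [← klMap_comp, e.inv_hom_id, klMap_id]

variable [MonoidalCategory W] [M.toFunctor.LaxMonoidal]

/-- The monoidal product of Kleisli arrows `f : A ⟶ M X` and `g : B ⟶ M Y` is
`(f ⊗ g) ≫ ∇ : A ⊗ B ⟶ M (X ⊗ Y)`; the coherence isomorphisms come from the base category. -/
instance kleisliMonoidalStruct : MonoidalCategoryStruct (Kleisli M) where
  tensorObj X Y := Kleisli.mk M (X.of ⊗ Y.of)
  tensorUnit := Kleisli.mk M (𝟙_ W)
  tensorHom f g := Kleisli.Hom.mk ((f.of ⊗ₘ g.of) ≫ μ M.toFunctor _ _)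
  whiskerLeft X _ _ f := Kleisli.Hom.mk ((M.η.app X.of ⊗ₘ f.of) ≫ μ M.toFunctor _ _)
  whiskerRight f Y := Kleisli.Hom.mk ((f.of ⊗ₘ M.η.app Y.of) ≫ μ M.toFunctor _ _)
  associator X Y Z := klIso M (α_ X.of Y.of Z.of)
  leftUnitor X := klIso M (λ_ X.of)
  rightUnitor X := klIso M (ρ_ X.of)

lemma kl_tensorHom_of {A B C D : Kleisli M} (f : A ⟶ B) (g : C ⟶ D) :
    (f ⊗ₘ g).of = (f.of ⊗ₘ g.of) ≫ μ M.toFunctor B.of D.of := rfl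

lemma kl_eta_tensor [NatTrans.IsMonoidal M.η] (X Y : W) :
    (M.η.app X ⊗ₘ M.η.app Y) ≫ μ M.toFunctor X Y = M.η.app (X ⊗ Y) := by
  have h := NatTrans.IsMonoidal.tensor (τ := M.η) X Y
  simpa using h.symm

lemma kl_eta_unit [NatTrans.IsMonoidal M.η] : M.η.app (𝟙_ W) = ε M.toFunctor := by
  have h := NatTrans.IsMonoidal.unit (τ := M.η)
  simpa using h

lemma kl_mu_tensor [NatTrans.IsMonoidal M.μ] (X Y : W) :
    (M.μ.app X ⊗ₘ M.μ.app Y) ≫ μ M.toFunctor X Y =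
      μ M.toFunctor (M.obj X) (M.obj Y) ≫ M.map (μ M.toFunctor X Y) ≫ M.μ.app (X ⊗ Y) := by
  have h := NatTrans.IsMonoidal.tensor (τ := M.μ) X Y
  simpa using h.symm

lemma klMap_tensor [NatTrans.IsMonoidal M.η] {X Y X' Y' : W} (f : X ⟶ Y) (g : X' ⟶ Y') :
    klMap M (f ⊗ₘ g) = klMap M f ⊗ₘ klMap M g := by
  apply Kleisli.hom_ext
  change (f ⊗ₘ g) ≫ M.η.app (Y ⊗ Y') = ((f ≫ M.η.app Y) ⊗ₘ (g ≫ M.η.app Y')) ≫ μ M.toFunctor Y Y'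
  rw [← tensorHom_comp_tensorHom, Category.assoc, kl_eta_tensor]

lemma kl_tensor_comp [NatTrans.IsMonoidal M.μ] {A₁ B₁ C₁ A₂ B₂ C₂ : Kleisli M}
    (f₁ : A₁ ⟶ B₁) (f₂ : A₂ ⟶ B₂) (g₁ : B₁ ⟶ C₁) (g₂ : B₂ ⟶ C₂) :
    (f₁ ⊗ₘ f₂) ≫ (g₁ ⊗ₘ g₂) = (f₁ ≫ g₁) ⊗ₘ (f₂ ≫ g₂) := by
  ext
  simp only [Kleisli.category_comp_of, kl_tensorHom_of, Functor.map_comp, Category.assoc,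
    ← tensorHom_comp_tensorHom, kl_mu_tensor]
  rw [μ_natural_assoc]
  rfl

lemma kl_assoc_natural {X₁ X₂ X₃ Y₁ Y₂ Y₃ : Kleisli M}
    (f₁ : X₁ ⟶ Y₁) (f₂ : X₂ ⟶ Y₂) (f₃ : X₃ ⟶ Y₃) :
    ((f₁ ⊗ₘ f₂) ⊗ₘ f₃) ≫ klMap M (α_ Y₁.of Y₂.of Y₃.of).hom =
      klMap M (α_ X₁.of X₂.of X₃.of).hom ≫ (f₁ ⊗ₘ (f₂ ⊗ₘ f₃)) := by
  apply Kleisli.hom_ext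
  refine (comp_klMap_of M ((f₁ ⊗ₘ f₂) ⊗ₘ f₃) (α_ Y₁.of Y₂.of Y₃.of).hom).trans ?_
  refine Eq.trans ?_ (klMap_comp_of M (α_ X₁.of X₂.of X₃.of).hom (f₁ ⊗ₘ (f₂ ⊗ₘ f₃))).symm
  change ((((f₁.of ⊗ₘ f₂.of) ≫ μ M.toFunctor Y₁.of Y₂.of) ⊗ₘ f₃.of) ≫
      μ M.toFunctor (Y₁.of ⊗ Y₂.of) Y₃.of) ≫ M.map (α_ Y₁.of Y₂.of Y₃.of).hom =
    (α_ X₁.of X₂.of X₃.of).hom ≫ (f₁.of ⊗ₘ ((f₂.of ⊗ₘ f₃.of) ≫ μ M.toFunctor Y₂.of Y₃.of)) ≫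
      μ M.toFunctor Y₁.of (Y₂.of ⊗ Y₃.of)
  have e₁ : (((f₁.of ⊗ₘ f₂.of) ≫ μ M.toFunctor Y₁.of Y₂.of) ⊗ₘ f₃.of) =
      ((f₁.of ⊗ₘ f₂.of) ⊗ₘ f₃.of) ≫ μ M.toFunctor Y₁.of Y₂.of ▷ M.obj Y₃.of := by
    rw [← tensorHom_id, tensorHom_comp_tensorHom, Category.comp_id]
  have e₂ : (f₁.of ⊗ₘ ((f₂.of ⊗ₘ f₃.of) ≫ μ M.toFunctor Y₂.of Y₃.of)) =
      (f₁.of ⊗ₘ (f₂.of ⊗ₘ f₃.of)) ≫ M.obj Y₁.of ◁ μ M.toFunctor Y₂.of Y₃.of := by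
    rw [← id_tensorHom, tensorHom_comp_tensorHom, Category.comp_id]
  rw [e₁, e₂, Category.assoc, Category.assoc, Category.assoc, associativity,
    associator_naturality_assoc]

instance kleisliMonoidal [NatTrans.IsMonoidal M.η] [NatTrans.IsMonoidal M.μ] :
    MonoidalCategory (Kleisli M) :=
  MonoidalCategory.ofTensorHom
    (id_tensorHom_id := fun X Y => Kleisli.hom_ext (T := M) (kl_eta_tensor M X.of Y.of))
    (id_tensorHom := fun _ _ _ _ => rfl)
    (tensorHom_id := fun _ _ => rfl)
    (tensorHom_comp_tensorHom := kl_tensor_comp M)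
    (associator_naturality := kl_assoc_natural M)
    (leftUnitor_naturality := by
      intro X Y f
      apply Kleisli.hom_ext
      refine (comp_klMap_of M (𝟙 (𝟙_ (Kleisli M)) ⊗ₘ f) (λ_ Y.of).hom).trans ?_
      refine Eq.trans ?_ (klMap_comp_of M (λ_ X.of).hom f).symm
      change ((M.η.app (𝟙_ W) ⊗ₘ f.of) ≫ μ M.toFunctor (𝟙_ W) Y.of) ≫ M.map (λ_ Y.of).hom = _
      rw [kl_eta_unit, ← leftUnitor_naturality, left_unitality, MonoidalCategory.tensorHom_def']
      simp only [Category.assoc]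
      rfl)
    (rightUnitor_naturality := by
      intro X Y f
      apply Kleisli.hom_ext
      refine (comp_klMap_of M (f ⊗ₘ 𝟙 (𝟙_ (Kleisli M))) (ρ_ Y.of).hom).trans ?_
      refine Eq.trans ?_ (klMap_comp_of M (ρ_ X.of).hom f).symm
      change ((f.of ⊗ₘ M.η.app (𝟙_ W)) ≫ μ M.toFunctor Y.of (𝟙_ W)) ≫ M.map (ρ_ Y.of).hom = _
      rw [kl_eta_unit, ← rightUnitor_naturality, right_unitality, MonoidalCategory.tensorHom_def]
      simp only [Category.assoc]
      rfl)
    (pentagon := by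
      intro A B C D
      have h := congrArg (klMap M) (pentagon A.of B.of C.of D.of)
      rw [← tensorHom_id, ← id_tensorHom] at h
      simp only [klMap_comp, klMap_tensor, klMap_id] at h
      exact h)
    (triangle := by
      intro A B
      have h := congrArg (klMap M) (triangle A.of B.of)
      rw [← tensorHom_id, ← id_tensorHom] at h
      simp only [klMap_comp, klMap_tensor, klMap_id] at h
      exact h)

/-- The functor `f ↦ f ≫ η` into the Kleisli category is strict monoidal. -/
instance toKleisliLaxMonoidal [NatTrans.IsMonoidal M.η] [NatTrans.IsMonoidal M.μ] :
    (Kleisli.Adjunction.toKleisli M).LaxMonoidal where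
  ε := 𝟙 (𝟙_ (Kleisli M))
  μ X Y := 𝟙 (Kleisli.mk M X ⊗ Kleisli.mk M Y)
  μ_natural_left f X := by
    refine (Category.comp_id (klMap M f ▷ Kleisli.mk M X)).trans
      (Eq.trans ?_ (Category.id_comp (klMap M (f ▷ X))).symm)
    rw [← tensorHom_id, ← tensorHom_id, klMap_tensor, klMap_id]
  μ_natural_right X f := by
    refine (Category.comp_id (Kleisli.mk M X ◁ klMap M f)).trans
      (Eq.trans ?_ (Category.id_comp (klMap M (X ◁ f))).symm)
    rw [← id_tensorHom, ← id_tensorHom, klMap_tensor, klMap_id]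
  associativity X Y Z := by
    change 𝟙 (Kleisli.mk M X ⊗ Kleisli.mk M Y) ▷ Kleisli.mk M Z ≫
        𝟙 ((Kleisli.mk M X ⊗ Kleisli.mk M Y) ⊗ Kleisli.mk M Z) ≫
          (α_ (Kleisli.mk M X) (Kleisli.mk M Y) (Kleisli.mk M Z)).hom =
      (α_ (Kleisli.mk M X) (Kleisli.mk M Y) (Kleisli.mk M Z)).hom ≫
        Kleisli.mk M X ◁ 𝟙 (Kleisli.mk M Y ⊗ Kleisli.mk M Z) ≫ 𝟙 _
    simp
  left_unitality X := by
    change (λ_ (Kleisli.mk M X)).hom = 𝟙 (𝟙_ (Kleisli M)) ▷ Kleisli.mk M X ≫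
      𝟙 (𝟙_ (Kleisli M) ⊗ Kleisli.mk M X) ≫ (λ_ (Kleisli.mk M X)).hom
    simp
  right_unitality X := by
    change (ρ_ (Kleisli.mk M X)).hom = Kleisli.mk M X ◁ 𝟙 (𝟙_ (Kleisli M)) ≫
      𝟙 (Kleisli.mk M X ⊗ 𝟙_ (Kleisli M)) ≫ (ρ_ (Kleisli.mk M X)).hom
    simp

end KleisliMonoidal

section KleisliSymmetric

variable {W : Type u} [Category.{v} W] [MonoidalCategory W] [SymmetricCategory W] (M : Monad W)
  [M.toFunctor.LaxBraided]

lemma kl_braiding_natural {X X' Y Y' : Kleisli M} (f : X ⟶ Y) (g : X' ⟶ Y') :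
    (f ⊗ₘ g) ≫ klMap M (β_ Y.of Y'.of).hom = klMap M (β_ X.of X'.of).hom ≫ (g ⊗ₘ f) := by
  apply Kleisli.hom_ext
  refine (comp_klMap_of M (f ⊗ₘ g) (β_ Y.of Y'.of).hom).trans ?_
  refine Eq.trans ?_ (klMap_comp_of M (β_ X.of X'.of).hom (g ⊗ₘ f)).symm
  simp only [kl_tensorHom_of, Category.assoc]
  rw [Functor.LaxBraided.braided, BraidedCategory.braiding_naturality_assoc]

variable [NatTrans.IsMonoidal M.η] [NatTrans.IsMonoidal M.μ]

instance kleisliSymmetric : SymmetricCategory (Kleisli M) where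
  braiding X Y := klIso M (β_ X.of Y.of)
  braiding_naturality_right X _ _ f := kl_braiding_natural M (𝟙 X) f
  braiding_naturality_left f X := kl_braiding_natural M f (𝟙 X)
  hexagon_forward X Y Z := by
    have h := congrArg (klMap M) (BraidedCategory.hexagon_forward X.of Y.of Z.of)
    rw [← tensorHom_id, ← id_tensorHom] at h
    simp only [klMap_comp, klMap_tensor, klMap_id] at h
    exact h
  hexagon_reverse X Y Z := by
    have h := congrArg (klMap M) (BraidedCategory.hexagon_reverse X.of Y.of Z.of)
    rw [← tensorHom_id, ← id_tensorHom] at h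
    simp only [klMap_comp, klMap_tensor, klMap_id] at h
    exact h
  symmetry X Y := by
    have h := congrArg (klMap M) (SymmetricCategory.symmetry X.of Y.of)
    simp only [klMap_comp, klMap_id] at h
    exact h

instance toKleisliLaxBraided : (Kleisli.Adjunction.toKleisli M).LaxBraided where
  braided X Y := (Category.id_comp (klMap M (β_ X Y).hom)).trans
    (Category.comp_id (klMap M (β_ X Y).hom)).symm

end KleisliSymmetric
section PartialSlice

variable {D : Type u} [Category.{v} D] [MonoidalCategory D]

/-- A full subcategory (given by a property of objects) is a strict monoidal subcategory if it
contains the unit, is closed under the monoidal product, and this product is strictly associative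
and unital on it, the associators and unitors being identities. -/
class IsStrictMonoidal (P : ObjectProperty D) : Prop extends P.IsMonoidal where
  assoc_obj : ∀ {A B C : D}, P A → P B → P C → (A ⊗ B) ⊗ C = A ⊗ (B ⊗ C)
  assoc_hom : ∀ {A B C : D} (hA : P A) (hB : P B) (hC : P C),
    (α_ A B C).hom = eqToHom (assoc_obj hA hB hC)
  left_obj : ∀ {A : D}, P A → 𝟙_ D ⊗ A = A
  left_hom : ∀ {A : D} (hA : P A), (λ_ A).hom = eqToHom (left_obj hA)
  right_obj : ∀ {A : D}, P A → A ⊗ 𝟙_ D = A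
  right_hom : ∀ {A : D} (hA : P A), (ρ_ A).hom = eqToHom (right_obj hA)

section StrictLemmas

variable {P : ObjectProperty D} [IsStrictMonoidal P]

lemma strict_assoc {U₁ U₂ U₃ A₁ A₂ A₃ : D} (h₁ : P U₁) (h₂ : P U₂) (h₃ : P U₃)
    (f₁ : U₁ ⟶ A₁) (f₂ : U₂ ⟶ A₂) (f₃ : U₃ ⟶ A₃) :
    ((f₁ ⊗ₘ f₂) ⊗ₘ f₃) ≫ (α_ A₁ A₂ A₃).hom =
      eqToHom (IsStrictMonoidal.assoc_obj h₁ h₂ h₃) ≫ (f₁ ⊗ₘ (f₂ ⊗ₘ f₃)) := by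
  rw [associator_naturality, IsStrictMonoidal.assoc_hom h₁ h₂ h₃]

lemma strict_assoc' {U₁ U₂ U₃ A₁ A₂ A₃ : D} (h₁ : P U₁) (h₂ : P U₂) (h₃ : P U₃)
    (k₁ : P A₁) (k₂ : P A₂) (k₃ : P A₃) (f₁ : U₁ ⟶ A₁) (f₂ : U₂ ⟶ A₂) (f₃ : U₃ ⟶ A₃) :
    ((f₁ ⊗ₘ f₂) ⊗ₘ f₃) = eqToHom (IsStrictMonoidal.assoc_obj h₁ h₂ h₃) ≫
      (f₁ ⊗ₘ (f₂ ⊗ₘ f₃)) ≫ eqToHom (IsStrictMonoidal.assoc_obj k₁ k₂ k₃).symm := by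
  have h := strict_assoc h₁ h₂ h₃ f₁ f₂ f₃
  rw [IsStrictMonoidal.assoc_hom k₁ k₂ k₃] at h
  rw [← Category.assoc, ← h, Category.assoc, eqToHom_trans, eqToHom_refl, Category.comp_id]

lemma strict_left {U A : D} (h : P U) (f : U ⟶ A) :
    f = eqToHom (IsStrictMonoidal.left_obj h).symm ≫ (𝟙 (𝟙_ D) ⊗ₘ f) ≫ (λ_ A).hom := by
  rw [id_tensorHom, leftUnitor_naturality, IsStrictMonoidal.left_hom h, eqToHom_trans_assoc,
    eqToHom_refl, Category.id_comp]

lemma strict_left' {U A : D} (h : P U) (k : P A) (f : U ⟶ A) :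
    f = eqToHom (IsStrictMonoidal.left_obj h).symm ≫ (𝟙 (𝟙_ D) ⊗ₘ f) ≫
      eqToHom (IsStrictMonoidal.left_obj k) := by
  rw [← IsStrictMonoidal.left_hom k, ← strict_left h]

lemma strict_right {U A : D} (h : P U) (f : U ⟶ A) :
    f = eqToHom (IsStrictMonoidal.right_obj h).symm ≫ (f ⊗ₘ 𝟙 (𝟙_ D)) ≫ (ρ_ A).hom := by
  rw [tensorHom_id, rightUnitor_naturality, IsStrictMonoidal.right_hom h, eqToHom_trans_assoc,
    eqToHom_refl, Category.id_comp]

lemma strict_right' {U A : D} (h : P U) (k : P A) (f : U ⟶ A) :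
    f = eqToHom (IsStrictMonoidal.right_obj h).symm ≫ (f ⊗ₘ 𝟙 (𝟙_ D)) ≫
      eqToHom (IsStrictMonoidal.right_obj k) := by
  rw [← IsStrictMonoidal.right_hom k, ← strict_right h]

end StrictLemmas

variable (P : ObjectProperty D)

/-- The partial slice functor: an object `A` goes to the comma category `(i ↓ A)` of arrows
`U ⟶ A` with `U` in the full subcategory `P`, and arrows act by post-composition. -/
abbrev partialSlice : D ⥤ Cat.{v, max u v} := CostructuredArrow.functor P.ι

lemma slice_obj_ext {A : D} {x y : CostructuredArrow P.ι A} (h : x.left.obj = y.left.obj)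
    (hh : x.hom = eqToHom h ≫ y.hom) : x = y := by
  obtain ⟨⟨X, hX⟩, ⟨⟨⟩⟩, f⟩ := x
  obtain ⟨⟨Y, hY⟩, ⟨⟨⟩⟩, g⟩ := y
  change X = Y at h
  subst h
  have : f = g := by
    have h2 := hh
    simp only [eqToHom_refl] at h2
    exact h2.trans (Category.id_comp g)
  subst this
  rfl

lemma slice_eqToHom {A : D} {x y : CostructuredArrow P.ι A} (h : x = y) :
    (eqToHom h).left.hom = eqToHom (by rw [h]) := by
  subst h
  rfl

lemma slice_hom_ext {A : D} {x y : CostructuredArrow P.ι A} {f g : x ⟶ y}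
    (h : f.left.hom = g.left.hom) : f = g :=
  CostructuredArrow.hom_ext _ _ (ObjectProperty.hom_ext _ h)

lemma slice_functor_ext {X : Type*} [Category* X] {A : D} {F G : X ⥤ CostructuredArrow P.ι A}
    (h : ∀ x, (F.obj x).left.obj = (G.obj x).left.obj)
    (hh : ∀ x, (F.obj x).hom = eqToHom (h x) ≫ (G.obj x).hom)
    (hm : ∀ {x y : X} (f : x ⟶ y),
      (F.map f).left.hom = eqToHom (h x) ≫ (G.map f).left.hom ≫ eqToHom (h y).symm) : F = G := by
  refine CategoryTheory.Functor.ext (fun x => slice_obj_ext P (h x) (hh x)) (fun x y f => slice_hom_ext P ?_)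
  rw [CostructuredArrow.comp_left, CostructuredArrow.comp_left]
  change _ = InducedCategory.Hom.hom _ ≫ InducedCategory.Hom.hom _ ≫ InducedCategory.Hom.hom _
  rw [slice_eqToHom, slice_eqToHom, hm f]

section
variable [P.IsMonoidal]

/-- The functor `1 ⥤ U/I` that picks the identity of the unit object. -/
def sliceUnit : (𝟙_ Cat.{v, max u v} : Cat) ⥤ CostructuredArrow P.ι (𝟙_ D) :=
  (Functor.const _).obj
    (CostructuredArrow.mk (Y := (⟨𝟙_ D, P.prop_unit⟩ : P.FullSubcategory)) (𝟙 (𝟙_ D)))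

/-- The functor `U/A × U/B ⥤ U/(A ⊗ B)` that sends `(f, g)` to `f ⊗ g` and `(φ, ψ)` to `φ ⊗ ψ`. -/
def sliceTensor (A B : D) :
    CostructuredArrow P.ι A × CostructuredArrow P.ι B ⥤ CostructuredArrow P.ι (A ⊗ B) where
  obj x := CostructuredArrow.mk
    (Y := (⟨x.1.left.obj ⊗ x.2.left.obj,
      ObjectProperty.prop_tensor x.1.left.property x.2.left.property⟩ : P.FullSubcategory))
    (x.1.hom ⊗ₘ x.2.hom)
  map {x y} φ := CostructuredArrow.homMk
    (ObjectProperty.homMk (φ.1.left.hom ⊗ₘ φ.2.left.hom))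
    (by
      have h₁ := CostructuredArrow.w φ.1
      have h₂ := CostructuredArrow.w φ.2
      change (φ.1.left.hom ⊗ₘ φ.2.left.hom) ≫ (y.1.hom ⊗ₘ y.2.hom) = x.1.hom ⊗ₘ x.2.hom
      rw [← h₁, ← h₂]
      exact tensorHom_comp_tensorHom _ _ _ _)
  map_id x := slice_hom_ext P (id_tensorHom_id _ _)
  map_comp φ ψ := slice_hom_ext P (tensorHom_comp_tensorHom _ _ _ _).symm

end

instance partialSliceLaxMonoidal [IsStrictMonoidal P] : (partialSlice P).LaxMonoidal where
  ε := (sliceUnit P).toCatHom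
  μ A B := (sliceTensor P A B).toCatHom
  μ_natural_left {A B} f X := by
    apply Cat.ext
    refine slice_functor_ext P (fun _ => rfl) (fun x => ?_) (fun φ => ?_)
    · change (x.1.hom ≫ f) ⊗ₘ x.2.hom = 𝟙 _ ≫ (x.1.hom ⊗ₘ x.2.hom) ≫ f ▷ X
      rw [Category.id_comp, ← tensorHom_id, tensorHom_comp_tensorHom, Category.comp_id]
    · exact ((Category.id_comp _).trans (Category.comp_id _)).symm
  μ_natural_right {A B} X f := by
    apply Cat.ext
    refine slice_functor_ext P (fun _ => rfl) (fun x => ?_) (fun φ => ?_)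
    · change x.1.hom ⊗ₘ (x.2.hom ≫ f) = 𝟙 _ ≫ (x.1.hom ⊗ₘ x.2.hom) ≫ X ◁ f
      rw [Category.id_comp, ← id_tensorHom, tensorHom_comp_tensorHom, Category.comp_id]
    · exact ((Category.id_comp _).trans (Category.comp_id _)).symm
  associativity A B C := by
    apply Cat.ext
    exact slice_functor_ext P
      (fun x => IsStrictMonoidal.assoc_obj x.1.1.left.property x.1.2.left.property
        x.2.left.property)
      (fun x => strict_assoc x.1.1.left.property x.1.2.left.property x.2.left.property
        x.1.1.hom x.1.2.hom x.2.hom)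
      (fun {x y} φ => strict_assoc' x.1.1.left.property x.1.2.left.property x.2.left.property
        y.1.1.left.property y.1.2.left.property y.2.left.property
        φ.1.1.left.hom φ.1.2.left.hom φ.2.left.hom)
  left_unitality A := by
    apply Cat.ext
    exact slice_functor_ext P
      (fun x => (IsStrictMonoidal.left_obj x.2.left.property).symm)
      (fun x => strict_left x.2.left.property x.2.hom)
      (fun {x y} φ => strict_left' x.2.left.property y.2.left.property φ.2.left.hom)
  right_unitality A := by
    apply Cat.ext
    exact slice_functor_ext P
      (fun x => (IsStrictMonoidal.right_obj x.1.left.property).symm)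
      (fun x => strict_right x.1.left.property x.1.hom)
      (fun {x y} φ => strict_right' x.1.left.property y.1.left.property φ.1.left.hom)

end PartialSlice

section EnrichedMonoidal

variable {V : Type u₁} [Category.{v₁} V] [MonoidalCategory V]

/-- Pre-composition of `g : A ⟶ C(Y, Z)` with `t : I ⟶ C(X, Y)`. -/
def ePre {C : Type u₃} [EnrichedCategory V C] {A : V} {X Y Z : C}
    (t : 𝟙_ V ⟶ (X ⟶[V] Y)) (g : A ⟶ (Y ⟶[V] Z)) : A ⟶ (X ⟶[V] Z) :=
  (λ_ A).inv ≫ (t ⊗ₘ g) ≫ eComp V X Y Z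

/-- Post-composition of `f : A ⟶ C(X, Y)` with `t : I ⟶ C(Y, Z)`. -/
def ePost {C : Type u₃} [EnrichedCategory V C] {A : V} {X Y Z : C}
    (f : A ⟶ (X ⟶[V] Y)) (t : 𝟙_ V ⟶ (Y ⟶[V] Z)) : A ⟶ (X ⟶[V] Z) :=
  (ρ_ A).inv ≫ (f ⊗ₘ t) ≫ eComp V X Y Z

variable [SymmetricCategory V]

/-- The data of a monoidal product on a `V`-category: a unit object, a `V`-functor
`⊠ : C ⊗ C ⟶ C` (where `(C ⊗ C)((X₁, X₂), (Y₁, Y₂)) = C(X₁, Y₁) ⊗ C(X₂, Y₂)`), and coherence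
isomorphisms, that is, isomorphisms of the underlying category. -/
class EnrichedMonoidalStruct (V : Type u₁) [Category.{v₁} V] [MonoidalCategory V]
    [SymmetricCategory V] (C : Type u₃) [EnrichedCategory V C] where
  /-- the unit object -/
  unit : C
  /-- the product of objects -/
  box : C → C → C
  /-- the product on hom-objects -/
  boxHom (X₁ Y₁ X₂ Y₂ : C) :
    ((X₁ ⟶[V] Y₁) ⊗ (X₂ ⟶[V] Y₂)) ⟶ (box X₁ X₂ ⟶[V] box Y₁ Y₂)
  boxHom_id (X₁ X₂ : C) :
    (λ_ (𝟙_ V)).inv ≫ (eId V X₁ ⊗ₘ eId V X₂) ≫ boxHom X₁ X₁ X₂ X₂ = eId V (box X₁ X₂)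
  boxHom_comp (X₁ Y₁ Z₁ X₂ Y₂ Z₂ : C) :
    tensorμ (X₁ ⟶[V] Y₁) (X₂ ⟶[V] Y₂) (Y₁ ⟶[V] Z₁) (Y₂ ⟶[V] Z₂) ≫
        (eComp V X₁ Y₁ Z₁ ⊗ₘ eComp V X₂ Y₂ Z₂) ≫ boxHom X₁ Z₁ X₂ Z₂ =
      (boxHom X₁ Y₁ X₂ Y₂ ⊗ₘ boxHom Y₁ Z₁ Y₂ Z₂) ≫
        eComp V (box X₁ X₂) (box Y₁ Y₂) (box Z₁ Z₂)
  /-- the associator -/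
  assoc (X Y Z : C) :
    ForgetEnrichment.of V (box (box X Y) Z) ≅ ForgetEnrichment.of V (box X (box Y Z))
  /-- the left unitor -/
  left (X : C) : ForgetEnrichment.of V (box unit X) ≅ ForgetEnrichment.of V X
  /-- the right unitor -/
  right (X : C) : ForgetEnrichment.of V (box X unit) ≅ ForgetEnrichment.of V X

namespace EnrichedMonoidalStruct

variable {C : Type u₃} [EnrichedCategory V C] [EnrichedMonoidalStruct V C]

/-- The product of objects of the underlying category. -/
def box₀ (X Y : ForgetEnrichment V C) : ForgetEnrichment V C :=
  ForgetEnrichment.of V (box V (ForgetEnrichment.to V X) (ForgetEnrichment.to V Y))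

/-- The product of arrows of the underlying category:
`I ≅ I ⊗ I ⟶ C(X₁, Y₁) ⊗ C(X₂, Y₂) ⟶ C(X₁ ⊠ X₂, Y₁ ⊠ Y₂)`. -/
def boxHom₀ {X₁ Y₁ X₂ Y₂ : ForgetEnrichment V C} (f : X₁ ⟶ Y₁) (g : X₂ ⟶ Y₂) :
    box₀ X₁ X₂ ⟶ box₀ Y₁ Y₂ :=
  ForgetEnrichment.homOf V ((λ_ (𝟙_ V)).inv ≫
    (ForgetEnrichment.homTo V f ⊗ₘ ForgetEnrichment.homTo V g) ≫ boxHom _ _ _ _)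

variable (V)

/-- The associator as a `V`-arrow `I ⟶ C((X ⊠ Y) ⊠ Z, X ⊠ (Y ⊠ Z))`. -/
def assocV (X Y Z : C) : 𝟙_ V ⟶ (box V (box V X Y) Z ⟶[V] box V X (box V Y Z)) :=
  ForgetEnrichment.homTo V (assoc (V := V) X Y Z).hom

/-- The left unitor as a `V`-arrow `I ⟶ C(J ⊠ X, X)`. -/
def leftV (X : C) : 𝟙_ V ⟶ (box V (unit V) X ⟶[V] X) :=
  ForgetEnrichment.homTo V (left (V := V) X).hom

/-- The right unitor as a `V`-arrow `I ⟶ C(X ⊠ J, X)`. -/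
def rightV (X : C) : 𝟙_ V ⟶ (box V X (unit V) ⟶[V] X) :=
  ForgetEnrichment.homTo V (right (V := V) X).hom

end EnrichedMonoidalStruct

open EnrichedMonoidalStruct

/-- A monoidal `V`-category: the associator and the unitors are `V`-natural and satisfy the
pentagon and triangle identities. -/
class EnrichedMonoidal (V : Type u₁) [Category.{v₁} V] [MonoidalCategory V]
    [SymmetricCategory V] (C : Type u₃) [EnrichedCategory V C] extends
    EnrichedMonoidalStruct V C where
  assoc_natural (X X' Y Y' Z Z' : C) :
    ePre (assocV V X Y Z) ((α_ (X ⟶[V] X') (Y ⟶[V] Y') (Z ⟶[V] Z')).hom ≫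
        ((X ⟶[V] X') ◁ boxHom Y Y' Z Z') ≫ boxHom X X' (box Y Z) (box Y' Z')) =
      ePost ((boxHom X X' Y Y' ▷ (Z ⟶[V] Z')) ≫ boxHom (box X Y) (box X' Y') Z Z')
        (assocV V X' Y' Z')
  left_natural (X X' : C) :
    ePre (leftV V X) (𝟙 (X ⟶[V] X')) =
      ePost ((λ_ (X ⟶[V] X')).inv ≫ (eId V unit ▷ (X ⟶[V] X')) ≫
        boxHom unit unit X X') (leftV V X')
  right_natural (X X' : C) :
    ePre (rightV V X) (𝟙 (X ⟶[V] X')) =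
      ePost ((ρ_ (X ⟶[V] X')).inv ≫ ((X ⟶[V] X') ◁ eId V unit) ≫
        boxHom X X' unit unit) (rightV V X')
  pentagon (X Y Z T : C) :
    boxHom₀ (assoc X Y Z).hom (𝟙 (ForgetEnrichment.of V T)) ≫
        (assoc X (box Y Z) T).hom ≫
          boxHom₀ (𝟙 (ForgetEnrichment.of V X)) (assoc Y Z T).hom =
      (assoc (box X Y) Z T).hom ≫ (assoc X Y (box Z T)).hom
  triangle (X Y : C) :
    (assoc X unit Y).hom ≫
        boxHom₀ (𝟙 (ForgetEnrichment.of V X)) (left Y).hom =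
      boxHom₀ (right X).hom (𝟙 (ForgetEnrichment.of V Y))

/-- A symmetric monoidal `V`-category. -/
class EnrichedSymmetric (V : Type u₁) [Category.{v₁} V] [MonoidalCategory V]
    [SymmetricCategory V] (C : Type u₃) [EnrichedCategory V C] extends
    EnrichedMonoidal V C where
  /-- the symmetry, as a `V`-arrow `I ⟶ C(X ⊠ Y, Y ⊠ X)` -/
  symmV (X Y : C) : 𝟙_ V ⟶ (box X Y ⟶[V] box Y X)
  symm_natural (X X' Y Y' : C) :
    ePre (symmV X Y) ((β_ (X ⟶[V] X') (Y ⟶[V] Y')).hom ≫ boxHom Y Y' X X') =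
      ePost (boxHom X X' Y Y') (symmV X' Y')
  hexagon (X Y Z : C) :
    (assoc X Y Z).hom ≫ ForgetEnrichment.homOf V (symmV X (box Y Z)) ≫
        (assoc Y Z X).hom =
      boxHom₀ (ForgetEnrichment.homOf V (symmV X Y)) (𝟙 (ForgetEnrichment.of V Z)) ≫
        (assoc Y X Z).hom ≫
          boxHom₀ (𝟙 (ForgetEnrichment.of V Y)) (ForgetEnrichment.homOf V (symmV X Z))
  symm_unit (X : C) :
    ForgetEnrichment.homOf V (symmV X unit) ≫ (left X).hom = (right X).hom
  symm_symm (X Y : C) :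
    ForgetEnrichment.homOf V (symmV X Y) ≫ ForgetEnrichment.homOf V (symmV Y X) =
      𝟙 (ForgetEnrichment.of V (box X Y))

end EnrichedMonoidal

section ChangeOfBase

lemma base_unit {V : Type u₁} [Category.{v₁} V] [MonoidalCategory V]
    {W : Type u₂} [Category.{v₂} W] [MonoidalCategory W] (N : V ⥤ W) [N.LaxMonoidal] :
    ε N ≫ N.map (λ_ (𝟙_ V)).inv = (λ_ (𝟙_ W)).inv ≫ (ε N ⊗ₘ ε N) ≫ μ N (𝟙_ V) (𝟙_ V) := by
  rw [ε_tensorHom_comp_μ, leftUnitor_naturality_assoc, Iso.inv_hom_id_assoc]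

lemma base_unit_assoc {V : Type u₁} [Category.{v₁} V] [MonoidalCategory V]
    {W : Type u₂} [Category.{v₂} W] [MonoidalCategory W] (N : V ⥤ W) [N.LaxMonoidal] {Z : W}
    (k : N.obj (𝟙_ V ⊗ 𝟙_ V) ⟶ Z) :
    ε N ≫ N.map (λ_ (𝟙_ V)).inv ≫ k =
      (λ_ (𝟙_ W)).inv ≫ (ε N ⊗ₘ ε N) ≫ μ N (𝟙_ V) (𝟙_ V) ≫ k := by
  rw [← Category.assoc, base_unit]
  simp only [Category.assoc]

/-- The functor `f ↦ N_ε ≫ N f` between the underlying categories of a `V`-category `C` and of the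
`W`-category obtained from `C` by change of base along the lax monoidal functor `N`. -/
def changeOfBase₀ {V : Type u₁} [Category.{v₁} V] [MonoidalCategory V]
    {W : Type u₂} [Category.{v₂} W] [MonoidalCategory W] (N : V ⥤ W) [N.LaxMonoidal]
    (C : Type u₃) [EnrichedCategory V C] :
    ForgetEnrichment V C ⥤ ForgetEnrichment W (TransportEnrichment N C) where
  obj X := ForgetEnrichment.of W (C := TransportEnrichment N C)
    (ForgetEnrichment.to V (C := C) X)
  map {X Y} f := ForgetEnrichment.homOf W (C := TransportEnrichment N C)
    (X := ForgetEnrichment.to V (C := C) X) (Y := ForgetEnrichment.to V (C := C) Y)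
    (ε N ≫ N.map (ForgetEnrichment.homTo V (C := C) f))
  map_id X := by
    rw [ForgetEnrichment.homTo_id]
    exact ForgetEnrichment.homOf_eId W (C := TransportEnrichment N C) _
  map_comp {X Y Z} f g := by
    have key : ε N ≫ N.map (ForgetEnrichment.homTo V (C := C) (f ≫ g)) =
        (λ_ (𝟙_ W)).inv ≫ ((ε N ≫ N.map (ForgetEnrichment.homTo V (C := C) f)) ⊗ₘ
          (ε N ≫ N.map (ForgetEnrichment.homTo V (C := C) g))) ≫
        μ N _ _ ≫ N.map (eComp V (ForgetEnrichment.to V (C := C) X)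
          (ForgetEnrichment.to V (C := C) Y) (ForgetEnrichment.to V (C := C) Z)) := by
      rw [ForgetEnrichment.homTo_comp, ← tensorHom_comp_tensorHom, Functor.map_comp,
        Functor.map_comp]
      simp only [Category.assoc, μ_natural_assoc]
      rw [base_unit_assoc]
    rw [key]
    exact ForgetEnrichment.homOf_comp W (C := TransportEnrichment N C) _ _

variable {V : Type u₁} [Category.{v₁} V] [MonoidalCategory V] (N : V ⥤ Cat.{v₂, u₂})
  [N.LaxMonoidal] (C : Type u₃) [EnrichedCategory V C]

/-- The 2-category `N_* C` obtained from a `V`-category `C` by change of base along a lax monoidal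
functor `N : V ⥤ Cat`. -/
abbrev BaseChange2 := CatEnriched (TransportEnrichment N C)

variable {C}

/-- An object of `C`, as a 0-cell of `N_* C`. -/
def zeroCell (X : C) : BaseChange2 N C := X

/-- The object of `C` that underlies a 0-cell of `N_* C`. -/
def ofZeroCell (X : BaseChange2 N C) : C := X

/-- The 1-cell `1 ⟶ N I ⟶ N C(X, Y)` of `N_* C` that comes from `t : I ⟶ C(X, Y)`. -/
def liftCell {X Y : C} (t : 𝟙_ V ⟶ (X ⟶[V] Y)) : zeroCell N X ⟶ zeroCell N Y :=
  (ε N ≫ N.map t).toFunctor.obj ⟨⟨⟨⟩⟩⟩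

variable [SymmetricCategory V] [EnrichedMonoidalStruct V C]

open EnrichedMonoidalStruct

/-- The unit object of `N_* C`. -/
def unit2 : BaseChange2 N C := zeroCell N (unit V)

variable {N}

/-- The product of 0-cells of `N_* C`. -/
def box2 (X Y : BaseChange2 N C) : BaseChange2 N C :=
  zeroCell N (box V (ofZeroCell N X) (ofZeroCell N Y))

/-- The monoidal product of `N_* C` on 1-cells and 2-cells:
`N C(X₁, Y₁) × N C(X₂, Y₂) ⥤ N (C(X₁, Y₁) ⊗ C(X₂, Y₂)) ⥤ N C(X₁ ⊠ X₂, Y₁ ⊠ Y₂)`. -/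
def boxFunctor2 (X₁ Y₁ X₂ Y₂ : BaseChange2 N C) :
    (X₁ ⟶ Y₁) × (X₂ ⟶ Y₂) ⥤ (box2 X₁ X₂ ⟶ box2 Y₁ Y₂) :=
  (μ N (ofZeroCell N X₁ ⟶[V] ofZeroCell N Y₁) (ofZeroCell N X₂ ⟶[V] ofZeroCell N Y₂) ≫
    N.map (boxHom (ofZeroCell N X₁) (ofZeroCell N Y₁) (ofZeroCell N X₂)
      (ofZeroCell N Y₂))).toFunctor

/-- The monoidal product of two 1-cells of `N_* C`. -/
def boxHom2 {X₁ Y₁ X₂ Y₂ : BaseChange2 N C} (f : X₁ ⟶ Y₁) (g : X₂ ⟶ Y₂) :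
    box2 X₁ X₂ ⟶ box2 Y₁ Y₂ :=
  (boxFunctor2 X₁ Y₁ X₂ Y₂).obj (f, g)

/-- The associator 1-cells of `N_* C`. -/
def assoc2 (X Y Z : BaseChange2 N C) : box2 (box2 X Y) Z ⟶ box2 X (box2 Y Z) :=
  liftCell N (assocV V (ofZeroCell N X) (ofZeroCell N Y) (ofZeroCell N Z))

/-- The left unitor 1-cells of `N_* C`. -/
def left2 (X : BaseChange2 N C) : box2 (unit2 N) X ⟶ X :=
  liftCell N (leftV V (ofZeroCell N X))

/-- The right unitor 1-cells of `N_* C`. -/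
def right2 (X : BaseChange2 N C) : box2 X (unit2 N) ⟶ X :=
  liftCell N (rightV V (ofZeroCell N X))

end ChangeOfBase

section SymmetryCells

variable {V : Type u₁} [Category.{v₁} V] [MonoidalCategory V] [SymmetricCategory V]
  {N : V ⥤ Cat.{v₂, u₂}} [N.LaxMonoidal] {C : Type u₃} [EnrichedCategory V C]

/-- The symmetry 1-cells of `N_* C`. -/
def symm2 [EnrichedSymmetric V C] (X Y : BaseChange2 N C) : box2 X Y ⟶ box2 Y X :=
  liftCell N (EnrichedSymmetric.symmV (ofZeroCell N X) (ofZeroCell N Y))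

end SymmetryCells

section SliceLemmas

variable {V : Type u₁} [Category.{v₁} V] [MonoidalCategory V] [SymmetricCategory V]
  {D : Type u₂} [Category.{v₂} D] [MonoidalCategory D] [SymmetricCategory D]
  {G : V ⥤ D} [G.LaxBraided] {C : Type u₃} [EnrichedCategory V C]

open EnrichedMonoidalStruct

lemma slice_interchange [EnrichedMonoidalStruct V C] {X₁ Y₁ Z₁ X₂ Y₂ Z₂ : C}
    {A₁ A₂ B₁ B₂ : D} (f₁ : A₁ ⟶ G.obj (X₁ ⟶[V] Y₁)) (f₂ : A₂ ⟶ G.obj (X₂ ⟶[V] Y₂))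
    (g₁ : B₁ ⟶ G.obj (Y₁ ⟶[V] Z₁)) (g₂ : B₂ ⟶ G.obj (Y₂ ⟶[V] Z₂)) :
    tensorμ A₁ A₂ B₁ B₂ ≫ ((((((f₁ ⊗ₘ g₁) ≫ μ G _ _) ≫ G.map (eComp V X₁ Y₁ Z₁)) ⊗ₘ
        (((f₂ ⊗ₘ g₂) ≫ μ G _ _) ≫ G.map (eComp V X₂ Y₂ Z₂))) ≫ μ G _ _) ≫
          G.map (boxHom X₁ Z₁ X₂ Z₂)) =
      (((((f₁ ⊗ₘ f₂) ≫ μ G _ _) ≫ G.map (boxHom X₁ Y₁ X₂ Y₂)) ⊗ₘ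
        (((g₁ ⊗ₘ g₂) ≫ μ G _ _) ≫ G.map (boxHom Y₁ Z₁ Y₂ Z₂))) ≫ μ G _ _) ≫
          G.map (eComp V (box V X₁ X₂) (box V Y₁ Y₂) (box V Z₁ Z₂)) := by
  simp only [← tensorHom_comp_tensorHom, Category.assoc, μ_natural_assoc, ← G.map_comp]
  rw [← boxHom_comp, ← tensorμ_natural_assoc, G.map_comp, tensorμ_comp_μ_tensorHom_μ_comp_μ_assoc]
  simp only [G.map_comp]

lemma slice_pre {X Y Z : C} {A : D} (t : 𝟙_ V ⟶ (X ⟶[V] Y)) (h : A ⟶ G.obj (Y ⟶[V] Z)) :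
    ((((𝟙 (𝟙_ D) ≫ ε G) ≫ G.map t) ⊗ₘ h) ≫ μ G _ _) ≫ G.map (eComp V X Y Z) =
      (λ_ A).hom ≫ h ≫ G.map (ePre t (𝟙 (Y ⟶[V] Z))) := by
  have e₁ : (((𝟙 (𝟙_ D) ≫ ε G) ≫ G.map t) ⊗ₘ h) =
      (ε G ⊗ₘ h) ≫ (G.map t ⊗ₘ G.map (𝟙 (Y ⟶[V] Z))) := by
    rw [tensorHom_comp_tensorHom, Category.id_comp, G.map_id, Category.comp_id]
  rw [e₁, Category.assoc, Category.assoc, μ_natural_assoc, ε_tensorHom_comp_μ_assoc,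
    leftUnitor_naturality_assoc, ePre]
  simp only [G.map_comp]

lemma slice_post {X Y Z : C} {A : D} (h : A ⟶ G.obj (X ⟶[V] Y)) (t : 𝟙_ V ⟶ (Y ⟶[V] Z)) :
    ((h ⊗ₘ ((𝟙 (𝟙_ D) ≫ ε G) ≫ G.map t)) ≫ μ G _ _) ≫ G.map (eComp V X Y Z) =
      (ρ_ A).hom ≫ h ≫ G.map (ePost (𝟙 (X ⟶[V] Y)) t) := by
  have e₁ : (h ⊗ₘ ((𝟙 (𝟙_ D) ≫ ε G) ≫ G.map t)) =
      (h ⊗ₘ ε G) ≫ (G.map (𝟙 (X ⟶[V] Y)) ⊗ₘ G.map t) := by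
    rw [tensorHom_comp_tensorHom, Category.id_comp, G.map_id, Category.comp_id]
  rw [e₁, Category.assoc, Category.assoc, μ_natural_assoc, tensorHom_ε_comp_μ_assoc,
    rightUnitor_naturality_assoc, ePost]
  simp only [G.map_comp]

lemma comp_ePre {X Y Z : C} {A B : V} (t : 𝟙_ V ⟶ (X ⟶[V] Y)) (k : B ⟶ A)
    (g : A ⟶ (Y ⟶[V] Z)) : ePre t (k ≫ g) = k ≫ ePre t g := by
  simp only [ePre]
  rw [leftUnitor_inv_naturality_assoc, ← id_tensorHom, tensorHom_comp_tensorHom_assoc,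
    Category.id_comp]

lemma comp_ePost {X Y Z : C} {A B : V} (k : B ⟶ A) (f : A ⟶ (X ⟶[V] Y))
    (t : 𝟙_ V ⟶ (Y ⟶[V] Z)) : ePost (k ≫ f) t = k ≫ ePost f t := by
  simp only [ePost]
  rw [rightUnitor_inv_naturality_assoc, ← tensorHom_id, tensorHom_comp_tensorHom_assoc,
    Category.id_comp]

lemma slice_symm [EnrichedSymmetric V C] {X₁ Y₁ X₂ Y₂ : C} {A₁ A₂ : D}
    (f₁ : A₁ ⟶ G.obj (X₁ ⟶[V] Y₁)) (f₂ : A₂ ⟶ G.obj (X₂ ⟶[V] Y₂)) :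
    (λ_ (A₂ ⊗ A₁) ≪≫ β_ A₂ A₁ ≪≫ (ρ_ (A₁ ⊗ A₂)).symm).hom ≫
      (((((f₁ ⊗ₘ f₂) ≫ μ G _ _) ≫ G.map (boxHom X₁ Y₁ X₂ Y₂)) ⊗ₘ
        ((𝟙 (𝟙_ D) ≫ ε G) ≫ G.map (EnrichedSymmetric.symmV Y₁ Y₂))) ≫ μ G _ _) ≫
          G.map (eComp V (box V X₁ X₂) (box V Y₁ Y₂) (box V Y₂ Y₁)) =
      ((((𝟙 (𝟙_ D) ≫ ε G) ≫ G.map (EnrichedSymmetric.symmV X₁ X₂)) ⊗ₘ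
        (((f₂ ⊗ₘ f₁) ≫ μ G _ _) ≫ G.map (boxHom X₂ Y₂ X₁ Y₁))) ≫ μ G _ _) ≫
          G.map (eComp V (box V X₁ X₂) (box V X₂ X₁) (box V Y₂ Y₁)) := by
  rw [slice_pre, slice_post]
  have h := EnrichedSymmetric.symm_natural (V := V) X₁ Y₁ X₂ Y₂
  rw [comp_ePre] at h
  have h₁ := comp_ePost (boxHom X₁ Y₁ X₂ Y₂) (𝟙 _) (EnrichedSymmetric.symmV (V := V) Y₁ Y₂)
  have h₂ := comp_ePre (EnrichedSymmetric.symmV (V := V) X₁ X₂) (boxHom X₂ Y₂ X₁ Y₁) (𝟙 _)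
  rw [Category.comp_id] at h₁ h₂
  simp only [Iso.trans_hom, Iso.symm_hom, Category.assoc, Iso.inv_hom_id_assoc, ← G.map_comp,
    ← h₁, ← h₂, ← h]
  rw [G.map_comp, Functor.LaxBraided.braided_assoc, BraidedCategory.braiding_naturality_assoc,
    SymmetricCategory.symmetry_assoc]

end SliceLemmas

section SliceCells

variable {V : Type u₁} [Category.{v₁} V] [MonoidalCategory V] [SymmetricCategory V]
  {D : Type u₂} [Category.{v₂} D] [MonoidalCategory D] [SymmetricCategory D]
  (P : ObjectProperty D) [IsStrictMonoidal P] (G : V ⥤ D)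
  {C : Type u₃} [EnrichedCategory V C]

/-- The change of base of `C` along `V ⥤ D ⥤ Cat`, the composite of `G` and the partial slice functor
of `P`. -/
abbrev SliceChange [G.LaxMonoidal] (C : Type u₃) [EnrichedCategory V C] :=
  BaseChange2 (G ⋙ partialSlice P) C

variable {P G}

/-- The parameter space of a 1-cell. -/
def cellDom [G.LaxMonoidal] {X Y : SliceChange P G C} (f : X ⟶ Y) : D :=
  (show CostructuredArrow P.ι (G.obj (ofZeroCell _ X ⟶[V] ofZeroCell _ Y)) from f).left.obj

lemma cellDom_prop [G.LaxMonoidal] {X Y : SliceChange P G C} (f : X ⟶ Y) : P (cellDom f) :=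
  (show CostructuredArrow P.ι (G.obj (ofZeroCell _ X ⟶[V] ofZeroCell _ Y)) from f).left.property

/-- The arrow `A ⟶ G C(X, Y)` of a 1-cell. -/
def cellHom [G.LaxMonoidal] {X Y : SliceChange P G C} (f : X ⟶ Y) :
    cellDom f ⟶ G.obj (ofZeroCell _ X ⟶[V] ofZeroCell _ Y) :=
  (show CostructuredArrow P.ι (G.obj (ofZeroCell _ X ⟶[V] ofZeroCell _ Y)) from f).hom

/-- The 1-cell of an arrow `A ⟶ G C(X, Y)` with parameter space `A`. -/
def mkCell [G.LaxMonoidal] (X Y : SliceChange P G C) (A : D) (hA : P A)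
    (f : A ⟶ G.obj (ofZeroCell _ X ⟶[V] ofZeroCell _ Y)) : X ⟶ Y :=
  show CostructuredArrow P.ι (G.obj (ofZeroCell _ X ⟶[V] ofZeroCell _ Y)) from
    CostructuredArrow.mk (Y := (⟨A, hA⟩ : P.FullSubcategory)) f

/-- The invertible 2-cell of an isomorphism of parameter spaces. -/
def mkIso2 [G.LaxMonoidal] {X Y : SliceChange P G C} {f g : X ⟶ Y}
    (e : cellDom f ≅ cellDom g) (w : e.hom ≫ cellHom g = cellHom f) : f ≅ g :=
  show (show CostructuredArrow P.ι (G.obj (ofZeroCell _ X ⟶[V] ofZeroCell _ Y)) from f) ≅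
      (show CostructuredArrow P.ι (G.obj (ofZeroCell _ X ⟶[V] ofZeroCell _ Y)) from g) from
    CostructuredArrow.isoMk (P.isoMk e) w


open EnrichedMonoidalStruct

/-- The tensorator `(f₁ ⊠ f₂) ≫ (g₁ ⊠ g₂) ≅ (f₁ ≫ g₁) ⊠ (f₂ ≫ g₂)`, given by the canonical symmetry
`(U₁ ⊗ U₂) ⊗ (V₁ ⊗ V₂) ≅ (U₁ ⊗ V₁) ⊗ (U₂ ⊗ V₂)` of the parameter spaces. -/
def tensorator2 [G.LaxBraided] [EnrichedMonoidalStruct V C]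
    {X₁ Y₁ Z₁ X₂ Y₂ Z₂ : SliceChange P G C} (f₁ : X₁ ⟶ Y₁) (f₂ : X₂ ⟶ Y₂) (g₁ : Y₁ ⟶ Z₁)
    (g₂ : Y₂ ⟶ Z₂) : boxHom2 f₁ f₂ ≫ boxHom2 g₁ g₂ ≅ boxHom2 (f₁ ≫ g₁) (f₂ ≫ g₂) :=
  mkIso2
    { hom := tensorμ (cellDom f₁) (cellDom f₂) (cellDom g₁) (cellDom g₂)
      inv := tensorδ (cellDom f₁) (cellDom f₂) (cellDom g₁) (cellDom g₂)
      hom_inv_id := tensorμ_tensorδ _ _ _ _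
      inv_hom_id := tensorδ_tensorμ _ _ _ _ }
    (slice_interchange _ _ _ _)

/-- The 2-cell of the symmetry, `s ≫ (f₂ ⊠ f₁) ≅ (f₁ ⊠ f₂) ≫ s`, given by the symmetry
`U₂ ⊗ U₁ ≅ U₁ ⊗ U₂` of the parameter spaces. -/
def symmIso2 [G.LaxBraided] [EnrichedSymmetric V C]
    {X₁ Y₁ X₂ Y₂ : SliceChange P G C} (f₁ : X₁ ⟶ Y₁) (f₂ : X₂ ⟶ Y₂) :
    symm2 X₁ X₂ ≫ boxHom2 f₂ f₁ ≅ boxHom2 f₁ f₂ ≫ symm2 Y₁ Y₂ :=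
  mkIso2 (λ_ (cellDom f₂ ⊗ cellDom f₁) ≪≫ β_ (cellDom f₂) (cellDom f₁) ≪≫
      (ρ_ (cellDom f₁ ⊗ cellDom f₂)).symm)
    (slice_symm _ _)

end SliceCells


section ParametricUncertainty

variable {W : Type u₂} [Category.{v₂} W] (M : Monad W)

/-- The full subcategory of the Kleisli category on the objects in `U`. -/
def kleisliProperty (U : ObjectProperty W) : ObjectProperty (Kleisli M) := fun X => U X.of

lemma klMap_eqToHom {X Y : W} (h : X = Y) :
    klMap M (eqToHom h) = eqToHom (congrArg (Kleisli.mk M) h) := by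
  subst h
  exact klMap_id M X

variable [MonoidalCategory W] [SymmetricCategory W] [M.toFunctor.LaxBraided]
  [NatTrans.IsMonoidal M.η] [NatTrans.IsMonoidal M.μ]

/-- A full strict monoidal subcategory of the base category gives one of the Kleisli category. -/
instance kleisliProperty_strict (U : ObjectProperty W) [IsStrictMonoidal U] :
    IsStrictMonoidal (kleisliProperty M U) where
  prop_unit := ObjectProperty.prop_unit U
  prop_tensor _ _ hX hY := ObjectProperty.prop_tensor (C := W) hX hY
  assoc_obj hA hB hC := congrArg (Kleisli.mk M) (IsStrictMonoidal.assoc_obj (P := U) hA hB hC)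
  assoc_hom hA hB hC := (congrArg (klMap M) (IsStrictMonoidal.assoc_hom (P := U) hA hB hC)).trans
    (klMap_eqToHom M _)
  left_obj hA := congrArg (Kleisli.mk M) (IsStrictMonoidal.left_obj (P := U) hA)
  left_hom hA := (congrArg (klMap M) (IsStrictMonoidal.left_hom (P := U) hA)).trans
    (klMap_eqToHom M _)
  right_obj hA := congrArg (Kleisli.mk M) (IsStrictMonoidal.right_obj (P := U) hA)
  right_hom hA := (congrArg (klMap M) (IsStrictMonoidal.right_hom (P := U) hA)).trans
    (klMap_eqToHom M _)

variable {V : Type u₁} [Category.{v₁} V] [MonoidalCategory V] [SymmetricCategory V]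

/-- The 2-category `(U/MF)_* C` of parametric `M`-uncertainty: the change of base of `C` along
`V ⥤ W ⥤ Kl_M ⥤ Cat`, the composite of `F`, of the functor into the Kleisli category, and of the
partial slice functor of `U`, regarded as a full subcategory of the Kleisli category. -/
abbrev ParamUncertaintyCat (U : ObjectProperty W) [IsStrictMonoidal (kleisliProperty M U)]
    (F : V ⥤ W) [F.LaxBraided] (C : Type u₃) [EnrichedCategory V C] :=
  SliceChange (kleisliProperty M U) (F ⋙ Kleisli.Adjunction.toKleisli M) C

/-- The 1-cell `F_ε ≫ F f ≫ η : I ⟶ M F C(X, Y)`, with the unit object as parameter space, of an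
arrow `f : I ⟶ C(X, Y)`. -/
def deltaCell (U : ObjectProperty W) [IsStrictMonoidal (kleisliProperty M U)]
    (F : V ⥤ W) [F.LaxBraided] {C : Type u₃} [EnrichedCategory V C] {X Y : C}
    (f : 𝟙_ V ⟶ (X ⟶[V] Y)) :
    (zeroCell _ X : ParamUncertaintyCat M U F C) ⟶ zeroCell _ Y :=
  mkCell (P := kleisliProperty M U) (G := F ⋙ Kleisli.Adjunction.toKleisli M)
    (zeroCell _ X) (zeroCell _ Y) (𝟙_ (Kleisli M)) (ObjectProperty.prop_unit _)
    (Kleisli.Hom.mk (ε F ≫ F.map f ≫ M.η.app (F.obj (X ⟶[V] Y))))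

end ParametricUncertainty

section StrictPreservation

variable {V : Type u₁} [Category.{v₁} V] [MonoidalCategory V] [SymmetricCategory V]
  {D : Type u₂} [Category.{v₂} D] [MonoidalCategory D] [SymmetricCategory D]
  {P : ObjectProperty D} [IsStrictMonoidal P] {G : V ⥤ D} [G.LaxBraided]
  {C : Type u₃} [EnrichedCategory V C]

open EnrichedMonoidalStruct

/-- The 2-functor `ι` on the underlying category of `C` (with identity 2-cells only) strictly
preserves the unit, the monoidal product of 0-cells and 1-cells, the associator and the unitors.
The 2-cells that witness interchange are identities on the image of `ι`. (The 2-cells of the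
underlying category are identities, so their products are preserved by functoriality.) -/
structure StrictlyPreservesMonoidal [EnrichedMonoidalStruct V C]
    (ι : StrictPseudofunctor (LocallyDiscrete (ForgetEnrichment V C)) (SliceChange P G C)) :
    Prop where
  unit_eq : ι.obj ⟨ForgetEnrichment.of V (unit V : C)⟩ = unit2 _
  box_eq (X Y : ForgetEnrichment V C) : ι.obj ⟨box₀ X Y⟩ = box2 (ι.obj ⟨X⟩) (ι.obj ⟨Y⟩)
  boxHom_eq {X₁ Y₁ X₂ Y₂ : ForgetEnrichment V C} (f : X₁ ⟶ Y₁) (g : X₂ ⟶ Y₂) :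
    ι.map (boxHom₀ f g).toLoc ≍ boxHom2 (ι.map f.toLoc) (ι.map g.toLoc)
  assoc_eq (X Y Z : C) :
    ι.map (assoc (V := V) X Y Z).hom.toLoc ≍
      assoc2 (ι.obj ⟨ForgetEnrichment.of V X⟩) (ι.obj ⟨ForgetEnrichment.of V Y⟩)
        (ι.obj ⟨ForgetEnrichment.of V Z⟩)
  left_eq (X : C) :
    ι.map (left (V := V) X).hom.toLoc ≍ left2 (ι.obj ⟨ForgetEnrichment.of V X⟩)
  right_eq (X : C) :
    ι.map (right (V := V) X).hom.toLoc ≍ right2 (ι.obj ⟨ForgetEnrichment.of V X⟩)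
  tensorator_eq {X₁ Y₁ Z₁ X₂ Y₂ Z₂ : ForgetEnrichment V C} (f₁ : X₁ ⟶ Y₁) (f₂ : X₂ ⟶ Y₂)
    (g₁ : Y₁ ⟶ Z₁) (g₂ : Y₂ ⟶ Z₂) :
    ∃ h, (tensorator2 (ι.map f₁.toLoc) (ι.map f₂.toLoc) (ι.map g₁.toLoc)
      (ι.map g₂.toLoc)).hom = eqToHom h

/-- The 2-functor `ι` strictly preserves the symmetry. The 2-cells that witness its naturality are
identities on the image of `ι`. -/
structure StrictlyPreservesSymmetry [EnrichedSymmetric V C]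
    (ι : StrictPseudofunctor (LocallyDiscrete (ForgetEnrichment V C)) (SliceChange P G C)) :
    Prop where
  symm_eq (X Y : C) :
    ι.map (ForgetEnrichment.homOf V (EnrichedSymmetric.symmV (V := V) X Y)).toLoc ≍
      symm2 (ι.obj ⟨ForgetEnrichment.of V X⟩) (ι.obj ⟨ForgetEnrichment.of V Y⟩)
  symmIso_eq {X₁ Y₁ X₂ Y₂ : ForgetEnrichment V C} (f₁ : X₁ ⟶ Y₁) (f₂ : X₂ ⟶ Y₂) :
    ∃ h, (symmIso2 (ι.map f₁.toLoc) (ι.map f₂.toLoc)).hom = eqToHom h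

end StrictPreservation

end ParamUncertainty

open ParamUncertainty

/-!
Write `N` for the composite of `F`, of the functor `L_M` into the Kleisli category and of the partial
slice functor. The 1-cell `F_ε ≫ F f ≫ η` is an object of the category `N C(X, Y)`, namely the one
that `N_ε ≫ N f : 1 ⟶ N I ⟶ N C(X, Y)` picks (`liftCell_eq_deltaCell`). So `ι` is an instance of a
2-functor that exists for every lax monoidal `N : V ⥤ Cat`. It is functorial, and it preserves the monoidal product of 1-cells, for the
same reason: `N_ε ≫ N (λ⁻¹ ≫ (t ⊗ s) ≫ k)` is the comparison arrow of `N` applied to the pair of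
`N_ε ≫ N t` and `N_ε ≫ N s`, followed by `N k`; take for `k` the composition of `C` or its product
on hom-objects (`toFunctor_ε_comp_map_tensorHom`). The unit, the associators, the unitors and the
symmetries of `N_* C` are by definition the images of those of `C`.

The tensorators and the symmetry 2-cells depend on the slice. A 2-cell there is an arrow of parameter
spaces, and it is an identity as soon as that arrow is one (`isEqToHom_mkIso2`). On the image of
`ι` the parameter spaces are products of unit objects, where the middle-four symmetry is composed of
associators and of the braiding `β_ I I = λ ≫ ρ⁻¹`, all of which are identities by strictness
(`isEqToHom_tensorμ_unit`).

For faithfulness, a 1-cell with parameter space `I` determines its arrow (`mkCell_injective`), which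
for `ι f` is `(F_ε ≫ F f) ≫ η`; the two hypotheses cancel `η` and then `F`.
-/

namespace ParamUncertainty

/-! ### The 2-functor on the underlying category, for an arbitrary change of base -/

section UnderlyingTwoFunctor

variable {V : Type u₁} [Category.{v₁} V] [MonoidalCategory V]

lemma ε_comp_map_tensorHom {W : Type u₂} [Category.{v₂} W] [MonoidalCategory W] (N : V ⥤ W)
    [N.LaxMonoidal] {A B E : V} (t : 𝟙_ V ⟶ A) (s : 𝟙_ V ⟶ B) (k : A ⊗ B ⟶ E) :
    ε N ≫ N.map ((λ_ (𝟙_ V)).inv ≫ (t ⊗ₘ s) ≫ k) =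
      (λ_ (𝟙_ W)).inv ≫ ((ε N ≫ N.map t) ⊗ₘ (ε N ≫ N.map s)) ≫ μ N A B ≫ N.map k := by
  rw [← tensorHom_comp_tensorHom, Functor.map_comp, Functor.map_comp, Category.assoc,
    μ_natural_assoc, base_unit_assoc]

variable (N : V ⥤ Cat.{v₂, u₂}) [N.LaxMonoidal]

/-- The object of `N E` picked by an arrow `𝟙_ V ⟶ E` that factors through a tensor product. -/
lemma toFunctor_ε_comp_map_tensorHom {A B E : V} (t : 𝟙_ V ⟶ A) (s : 𝟙_ V ⟶ B)
    (k : A ⊗ B ⟶ E) :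
    (ε N ≫ N.map ((λ_ (𝟙_ V)).inv ≫ (t ⊗ₘ s) ≫ k)).toFunctor.obj ⟨⟨⟨⟩⟩⟩ =
      (μ N A B ≫ N.map k).toFunctor.obj
        ((ε N ≫ N.map t).toFunctor.obj ⟨⟨⟨⟩⟩⟩, (ε N ≫ N.map s).toFunctor.obj ⟨⟨⟨⟩⟩⟩) :=
  congrArg (fun F => F.toFunctor.obj ⟨⟨⟨⟩⟩⟩) (ε_comp_map_tensorHom N t s k)

variable (C : Type u₃) [EnrichedCategory V C]

lemma liftCell_homTo_id (X : ForgetEnrichment V C) :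
    liftCell N (ForgetEnrichment.homTo V (𝟙 X)) =
      𝟙 (zeroCell N (ForgetEnrichment.to V X)) := by
  rw [ForgetEnrichment.homTo_id]
  rfl

lemma liftCell_homTo_comp {X Y Z : ForgetEnrichment V C} (f : X ⟶ Y) (g : Y ⟶ Z) :
    liftCell N (ForgetEnrichment.homTo V (f ≫ g)) =
      liftCell N (ForgetEnrichment.homTo V f) ≫ liftCell N (ForgetEnrichment.homTo V g) := by
  rw [ForgetEnrichment.homTo_comp, Category.assoc]
  exact toFunctor_ε_comp_map_tensorHom N _ _ _

/-- The strict 2-functor from the underlying category of a `V`-category `C`, with identity 2-cells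
only, to the change of base of `C` along a lax monoidal functor `N : V ⥤ Cat`. It is the identity
on objects and sends `f : I ⟶ C(X, Y)` to the object of `N C(X, Y)` picked by `N_ε ≫ N f`. -/
def underlyingTwoFunctor :
    StrictPseudofunctor (LocallyDiscrete (ForgetEnrichment V C)) (BaseChange2 N C) :=
  StrictPseudofunctor.mk''
    { obj X := zeroCell N (ForgetEnrichment.to V X.as)
      map f := liftCell N (ForgetEnrichment.homTo V f.as)
      map₂ η := eqToHom (by rw [LocallyDiscrete.eq_of_hom η])
      map₂_id _ := rfl
      map₂_comp _ _ := (eqToHom_trans _ _).symm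
      map_id X := liftCell_homTo_id N C X.as
      map_comp f g := liftCell_homTo_comp N C f.as g.as
      map₂_whisker_left f g g' η := by
        obtain rfl := LocallyDiscrete.eq_of_hom η
        simp only [eqToHom_refl, Bicategory.whiskerLeft_id, Category.id_comp]
        exact ((eqToHom_trans _ _).trans (eqToHom_refl _ _)).symm
      map₂_whisker_right η g := by
        obtain rfl := LocallyDiscrete.eq_of_hom η
        simp only [eqToHom_refl, Bicategory.id_whiskerRight, Category.id_comp]
        exact ((eqToHom_trans _ _).trans (eqToHom_refl _ _)).symm }

variable {C} [SymmetricCategory V]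

open EnrichedMonoidalStruct

lemma liftCell_homTo_boxHom₀ [EnrichedMonoidalStruct V C] {X₁ Y₁ X₂ Y₂ : ForgetEnrichment V C}
    (f : X₁ ⟶ Y₁) (g : X₂ ⟶ Y₂) :
    liftCell N (ForgetEnrichment.homTo V (boxHom₀ f g)) =
      boxHom2 (liftCell N (ForgetEnrichment.homTo V f))
        (liftCell N (ForgetEnrichment.homTo V g)) :=
  toFunctor_ε_comp_map_tensorHom N _ _ _

end UnderlyingTwoFunctor

/-! ### Arrows that are identities up to an equality of objects -/

section EqToHom

variable {D : Type u} [Category.{v} D]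

/-- The arrow `f` is an identity up to an equality of its domain and codomain. -/
def IsEqToHom {A B : D} (f : A ⟶ B) : Prop := ∃ h : A = B, f = eqToHom h

lemma IsEqToHom.comp {A B E : D} {f : A ⟶ B} {g : B ⟶ E} (hf : IsEqToHom f)
    (hg : IsEqToHom g) : IsEqToHom (f ≫ g) := by
  obtain ⟨rfl, rfl⟩ := hf
  obtain ⟨rfl, rfl⟩ := hg
  exact ⟨rfl, by simp⟩

lemma IsEqToHom.inv {A B : D} {e : A ≅ B} (h : IsEqToHom e.hom) : IsEqToHom e.inv := by
  obtain ⟨rfl, h⟩ := h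
  exact ⟨rfl, by rw [← cancel_epi e.hom, e.hom_inv_id, h]; simp⟩

variable [MonoidalCategory D]

lemma IsEqToHom.whiskerLeft (A : D) {B E : D} {f : B ⟶ E} (hf : IsEqToHom f) :
    IsEqToHom (A ◁ f) := by
  obtain ⟨rfl, rfl⟩ := hf
  exact ⟨rfl, by simp⟩

lemma IsEqToHom.whiskerRight {A B : D} {f : A ⟶ B} (hf : IsEqToHom f) (E : D) :
    IsEqToHom (f ▷ E) := by
  obtain ⟨rfl, rfl⟩ := hf
  exact ⟨rfl, by simp⟩

lemma isEqToHom_braiding_unit (P : ObjectProperty D) [IsStrictMonoidal P] [BraidedCategory D] :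
    IsEqToHom (β_ (𝟙_ D) (𝟙_ D)).hom := by
  have hI : P (𝟙_ D) := P.prop_unit
  rw [braiding_tensorUnit_left]
  exact IsEqToHom.comp ⟨_, IsStrictMonoidal.left_hom hI⟩
    (IsEqToHom.inv ⟨_, IsStrictMonoidal.right_hom hI⟩)

lemma isEqToHom_tensorμ_unit (P : ObjectProperty D) [IsStrictMonoidal P] [BraidedCategory D] :
    IsEqToHom (tensorμ (𝟙_ D) (𝟙_ D) (𝟙_ D) (𝟙_ D)) := by
  have hI : P (𝟙_ D) := P.prop_unit
  have hII : P (𝟙_ D ⊗ 𝟙_ D) := P.prop_tensor hI hI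
  have ha {A B E : D} (hA : P A) (hB : P B) (hE : P E) : IsEqToHom (α_ A B E).hom :=
    ⟨_, IsStrictMonoidal.assoc_hom hA hB hE⟩
  rw [tensorμ]
  exact (ha hI hI hII).comp ((((ha hI hI hI).inv.whiskerLeft _)).comp
    ((((isEqToHom_braiding_unit P).whiskerRight _).whiskerLeft _).comp
      (((ha hI hI hI).whiskerLeft _).comp (ha hI hI hII).inv)))

/-- An arrow of `U/A` is an identity, up to an equality of objects, as soon as its arrow of
parameter spaces is: the objects then have equal structure arrows too, by the commutative triangle. -/
lemma isEqToHom_of_left (P : ObjectProperty D) {A : D} {x y : CostructuredArrow P.ι A} {f : x ⟶ y}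
    (h : IsEqToHom f.left.hom) : IsEqToHom f := by
  obtain ⟨h, hf⟩ := h
  have hw := CostructuredArrow.w f
  have hxy : x = y := slice_obj_ext P h (by rw [← hf]; exact hw.symm)
  exact ⟨hxy, slice_hom_ext P (hf.trans (slice_eqToHom P hxy).symm)⟩

end EqToHom

/-! ### Change of base along a partial slice functor -/

section SliceChange

variable {V : Type u₁} [Category.{v₁} V] [MonoidalCategory V] [SymmetricCategory V]
  {D : Type u₂} [Category.{v₂} D] [MonoidalCategory D] [SymmetricCategory D]
  (P : ObjectProperty D) [IsStrictMonoidal P] (G : V ⥤ D) [G.LaxBraided]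
  {C : Type u₃} [EnrichedCategory V C]

lemma isEqToHom_mkIso2 {X Y : SliceChange P G C} {f g : X ⟶ Y} (e : cellDom f ≅ cellDom g)
    (w : e.hom ≫ cellHom g = cellHom f) (h : IsEqToHom e.hom) :
    IsEqToHom (mkIso2 e w).hom :=
  isEqToHom_of_left P
    (x := (show CostructuredArrow P.ι (G.obj (ofZeroCell _ X ⟶[V] ofZeroCell _ Y)) from f))
    (y := (show CostructuredArrow P.ι (G.obj (ofZeroCell _ X ⟶[V] ofZeroCell _ Y)) from g))
    (f := (CostructuredArrow.isoMk (P.isoMk e) w).hom) h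

lemma strictlyPreservesMonoidal_underlyingTwoFunctor [EnrichedMonoidalStruct V C] :
    StrictlyPreservesMonoidal (underlyingTwoFunctor (G ⋙ partialSlice P) C) where
  unit_eq := rfl
  box_eq _ _ := rfl
  boxHom_eq f g := heq_of_eq (liftCell_homTo_boxHom₀ (G ⋙ partialSlice P) f g)
  assoc_eq _ _ _ := HEq.rfl
  left_eq _ := HEq.rfl
  right_eq _ := HEq.rfl
  tensorator_eq _ _ _ _ := isEqToHom_mkIso2 P G _ _ (isEqToHom_tensorμ_unit P)

lemma strictlyPreservesSymmetry_underlyingTwoFunctor [EnrichedSymmetric V C] :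
    StrictlyPreservesSymmetry (underlyingTwoFunctor (G ⋙ partialSlice P) C) where
  symm_eq _ _ := HEq.rfl
  symmIso_eq _ _ := by
    have hI : P (𝟙_ D) := P.prop_unit
    have hII : P (𝟙_ D ⊗ 𝟙_ D) := P.prop_tensor hI hI
    exact isEqToHom_mkIso2 P G _ _ (IsEqToHom.comp ⟨_, IsStrictMonoidal.left_hom hII⟩
      ((isEqToHom_braiding_unit P).comp (IsEqToHom.inv ⟨_, IsStrictMonoidal.right_hom hII⟩)))

lemma mkCell_injective {D : Type u₂} [Category.{v₂} D] [MonoidalCategory D]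
    {P : ObjectProperty D} [IsStrictMonoidal P] {G : V ⥤ D} [G.LaxMonoidal]
    {X Y : SliceChange P G C} {A : D} (hA : P A) :
    Function.Injective (mkCell X Y A hA) := by
  intro f g h
  have h' : (CostructuredArrow.mk (Y := (⟨A, hA⟩ : P.FullSubcategory)) f :
      CostructuredArrow P.ι (G.obj (ofZeroCell _ X ⟶[V] ofZeroCell _ Y))) =
    CostructuredArrow.mk (Y := (⟨A, hA⟩ : P.FullSubcategory)) g := h
  injection h'

end SliceChange

/-! ### The 2-category of parametric uncertainty -/

section Delta

variable {V : Type u₁} [Category.{v₁} V] [MonoidalCategory V] [SymmetricCategory V]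
  {W : Type u₂} [Category.{v₂} W] [MonoidalCategory W] [SymmetricCategory W]
  (M : Monad W) [M.toFunctor.LaxBraided] [NatTrans.IsMonoidal M.η] [NatTrans.IsMonoidal M.μ]
  (U : ObjectProperty W) [IsStrictMonoidal (kleisliProperty M U)]
  (F : V ⥤ W) [F.LaxBraided] {C : Type u₃} [EnrichedCategory V C]

/-- The unit comparison arrow of the composite picks `L_M F_ε`, with parameter space `I`, since those
of `L_M` and of the partial slice functor are identities. -/
lemma liftCell_eq_deltaCell {X Y : C} (f : 𝟙_ V ⟶ (X ⟶[V] Y)) :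
    liftCell ((F ⋙ Kleisli.Adjunction.toKleisli M) ⋙ partialSlice (kleisliProperty M U)) f =
      deltaCell M U F f := by
  refine congrArg (mkCell (P := kleisliProperty M U) (G := F ⋙ Kleisli.Adjunction.toKleisli M)
    (zeroCell _ X) (zeroCell _ Y) (𝟙_ (Kleisli M)) (ObjectProperty.prop_unit _)) ?_
  change (𝟙 _ ≫ 𝟙 (𝟙_ (Kleisli M)) ≫ klMap M (ε F)) ≫ klMap M (F.map f) = _
  rw [Category.id_comp, Category.id_comp, ← klMap_comp]
  exact Kleisli.hom_ext (Category.assoc _ _ _)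

end Delta

end ParamUncertainty

theorem proposition3p13 {V : Type u₁} [Category.{v₁} V] [MonoidalCategory V] [SymmetricCategory V]
    {W : Type u₂} [Category.{v₂} W] [MonoidalCategory W] [SymmetricCategory W]
    (M : Monad W) [M.toFunctor.LaxBraided] [NatTrans.IsMonoidal M.η] [NatTrans.IsMonoidal M.μ]
    (U : ObjectProperty W) [IsStrictMonoidal (kleisliProperty M U)]
    (F : V ⥤ W) [F.LaxBraided] (C : Type u₃) [EnrichedCategory V C] :
    ∃ ι : StrictPseudofunctor (LocallyDiscrete (ForgetEnrichment V C)) (ParamUncertaintyCat M U F C),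
      (∀ X : C, ι.obj ⟨ForgetEnrichment.of V X⟩ = zeroCell _ X) ∧
      (∀ (X Y : C) (f : 𝟙_ V ⟶ (X ⟶[V] Y)),
        ι.map (ForgetEnrichment.homOf V f).toLoc ≍ deltaCell M U F f) ∧
      (∀ [EnrichedMonoidal V C], StrictlyPreservesMonoidal ι) ∧
      (∀ [EnrichedSymmetric V C], StrictlyPreservesSymmetry ι) ∧
      ((changeOfBase₀ F C).Faithful →
        (∀ X Y : C, Function.Injective
          fun g : 𝟙_ W ⟶ F.obj (X ⟶[V] Y) => g ≫ M.η.app (F.obj (X ⟶[V] Y))) →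
        ∀ X Y : ForgetEnrichment V C, Function.Injective fun f : X ⟶ Y => ι.map f.toLoc) := by
  refine ⟨underlyingTwoFunctor _ C, fun _ => rfl,
    fun _ _ f => heq_of_eq (liftCell_eq_deltaCell M U F f),
    strictlyPreservesMonoidal_underlyingTwoFunctor _ _,
    strictlyPreservesSymmetry_underlyingTwoFunctor _ _, fun hF hη X Y f g h => ?_⟩
  have h' : deltaCell M U F (ForgetEnrichment.homTo V f) =
      deltaCell M U F (ForgetEnrichment.homTo V g) :=
    (liftCell_eq_deltaCell M U F _).symm.trans (h.trans (liftCell_eq_deltaCell M U F _))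
  refine hF.map_injective (hη _ _ ?_)
  have h₂ := congrArg Kleisli.Hom.of (mkCell_injective _ h')
  exact (Category.assoc _ _ _).trans (h₂.trans (Category.assoc _ _ _).symm)
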